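/- Let $\alpha$ be a countable ordinal with $\alpha\ge 1$, and for every limit ordinal $\delta\le\alpha$ fix a strictly increasing sequence $(\delta_k)_{k\in\mathbb N}$ of ordinals that is cofinal in $\delta$. Let $T_\alpha\subset\mathbb N^{<\omega}$ be the well-founded tree with rank function $\mathrm{rk}$ determined as follows: the root $\langle\rangle$ is in $T_\alpha$ and has rank $\alpha$; if $\sigma\in T_\alpha$ has rank $\beta+1$, then for all $k\in\mathbb N$, $\sigma\hat{\ }k\in T_\alpha$ and has rank $\beta$; if $\sigma\in T_\alpha$ has limit rank $\delta$, then for all $k\in\mathbb N$, $\sigma\hat{\ }k\in T_\alpha$ and has rank $\delta_k$; nodes of rank $0$ have no children. Let $\mathscr L_\alpha$ be the set of leaves of $T_\alpha$ (the nodes of rank $0$), and give $2^{\mathscr L_\alpha}=\{0,1\}^{\mathscr L_\alpha}$ the product topology. For $x\in 2^{\mathscr L_\alpha}$ let $F^x,I^x\colon T_\alpha\to\{0,1\}$ be the labellings defined by recursion as follows: $F^x(\sigma)=I^x(\sigma)=x(\sigma)$ for $\sigma\in\mathscr L_\alpha$, and for $\sigma\in T_\alpha\setminus\mathscr L_\alpha$,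 $$F^x(\sigma)=1\iff\{k\in\mathbb N: F^x(\sigma\hat{\ }k)=1\}\text{ is cofinite},$$ $$I^x(\sigma)=0\iff\{k\in\mathbb N: I^x(\sigma\hat{\ }k)=0\}\text{ is cofinite}.$$ The $\alpha$-th iterate of the Fréchet filter is $\mathcal F_\alpha=\{x\in 2^{\mathscr L_\alpha}:F^x(\langle\rangle)=1\}$, and the $\alpha$-th iterate of the Fréchet ideal is $\mathcal I_\alpha=\{x\in 2^{\mathscr L_\alpha}:I^x(\langle\rangle)=0\}$. **Theorem.** $\mathcal F_\alpha$ and $\mathcal I_\alpha$ cannot be separated by a $\mathbf\Delta^0_{\alpha+1}$ set: there is no set $Z\subseteq 2^{\mathscr L_\alpha}$ such that both $Z$ and its complement are $\mathbf\Sigma^0_{\alpha+1}$, $\mathcal F_\alpha\subseteq Z$ and $\mathcal I_\alpha\cap Z=\emptyset$. Here $\mathbf\Sigma^0_1$ is the class of open sets, and for $\beta>1$ a set is $\mathbf\Sigma^0_\beta$ if it is a union of countably many sets, each of which is the complement of a $\mathbf\Sigma^0_\gamma$ set for some $1\le\gamma<\beta$. -/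

import Mathlib

open scoped Ordinal

namespace IteratedFrechet

/-- A choice, for every limit ordinal `δ ≤ α`, of an increasing cofinal sequence
`(δ_k)` of ordinals below `δ` (the values of `seq` elsewhere are irrelevant). -/
structure CofinalSequences (α : Ordinal.{0}) where
  seq : Ordinal.{0} → ℕ → Ordinal.{0}
  strictMono : ∀ δ, δ ≤ α → Order.IsSuccLimit δ → StrictMono (seq δ)
  lt : ∀ δ, δ ≤ α → Order.IsSuccLimit δ → ∀ k, seq δ k < δ
  cofinal : ∀ δ, δ ≤ α → Order.IsSuccLimit δ → ∀ β, β < δ → ∃ k, β ≤ seq δ k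

namespace CofinalSequences

variable {α : Ordinal.{0}} (c : CofinalSequences α)

/-- `c.HasRank σ β`: the finite sequence `σ` is a node of the tree `T_α`, and its rank is `β`.
The root has rank `α`; a node of rank `β + 1` has the children `σ⌢k`, all of rank `β`; a node of
limit rank `δ` has the children `σ⌢k`, of rank `δ_k`; nodes of rank `0` have no children. -/
inductive HasRank : List ℕ → Ordinal.{0} → Prop
  | root : HasRank [] α
  | succ (σ : List ℕ) (β : Ordinal.{0}) (k : ℕ) :
      HasRank σ (Order.succ β) → HasRank (σ ++ [k]) β
  | limit (σ : List ℕ) (δ : Ordinal.{0}) (k : ℕ) :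
      Order.IsSuccLimit δ → HasRank σ δ → HasRank (σ ++ [k]) (c.seq δ k)

/-- The tree `T_α`. -/
def tree : Set (List ℕ) := {σ | ∃ β, c.HasRank σ β}

/-- The set `𝓛_α` of leaves of `T_α`. -/
def leaves : Set (List ℕ) := {σ | c.HasRank σ 0}

/-- The space `2^{𝓛_α}`; its topology is the product topology. -/
abbrev Space : Type := c.leaves → Bool

theorem HasRank.le {c : CofinalSequences α} {σ : List ℕ} {β : Ordinal.{0}}
    (h : c.HasRank σ β) : β ≤ α := by
  induction h with
  | root => exact le_rfl
  | succ σ β k _ ih => exact (Order.le_succ β).trans ih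
  | limit σ δ k hδ _ ih => exact (c.lt δ ih hδ k).le.trans ih

theorem HasRank.unique {c : CofinalSequences α} {σ : List ℕ} {β γ : Ordinal.{0}}
    (h : c.HasRank σ β) (h' : c.HasRank σ γ) : β = γ := by
  induction h generalizing γ with
  | root =>
    generalize hτ : ([] : List ℕ) = τ at h'
    cases h' with
    | root => rfl
    | succ => simp at hτ
    | limit => simp at hτ
  | succ σ β k h ih =>
    generalize hτ : σ ++ [k] = τ at h'
    cases h' with
    | root => simp at hτ
    | succ σ' _ k' h2 =>
      obtain ⟨rfl, hk⟩ := List.append_inj' hτ rfl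
      exact Order.succ_injective (ih h2)
    | limit σ' δ k' hδ h2 =>
      obtain ⟨rfl, hk⟩ := List.append_inj' hτ rfl
      exact absurd hδ (ih h2 ▸ Order.not_isSuccLimit_succ β)
  | limit σ δ k hδ h ih =>
    generalize hτ : σ ++ [k] = τ at h'
    cases h' with
    | root => simp at hτ
    | succ σ' _ k' h2 =>
      obtain ⟨rfl, hk⟩ := List.append_inj' hτ rfl
      exact absurd (ih h2 ▸ hδ) (Order.not_isSuccLimit_succ γ)
    | limit σ' δ' k' hδ' h2 =>
      obtain ⟨rfl, hk⟩ := List.append_inj' hτ rfl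
      obtain rfl := ih h2
      simp only [List.cons.injEq, and_true] at hk
      rw [hk]

theorem HasRank.child_lt {c : CofinalSequences α} {σ : List ℕ} {k : ℕ} {β γ : Ordinal.{0}}
    (h : c.HasRank σ β) (h' : c.HasRank (σ ++ [k]) γ) : γ < β := by
  generalize hτ : σ ++ [k] = τ at h'
  cases h' with
  | root => simp at hτ
  | succ σ' _ k' h2 =>
    obtain ⟨rfl, hk⟩ := List.append_inj' hτ rfl
    rw [h.unique h2]
    exact Order.lt_succ γ
  | limit σ' δ k' hδ h2 =>
    obtain ⟨rfl, hk⟩ := List.append_inj' hτ rfl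
    rw [h.unique h2]
    exact c.lt δ h2.le hδ k'

/-- A node which is not a leaf has all its children in the tree. -/
theorem child_mem_tree {σ : List ℕ} (hσ : σ ∈ c.tree) (hl : σ ∉ c.leaves) (k : ℕ) :
    σ ++ [k] ∈ c.tree := by
  obtain ⟨β, hβ⟩ := hσ
  rcases Ordinal.zero_or_succ_or_isSuccLimit β with rfl | ⟨γ, rfl⟩ | hlim
  · exact absurd hβ hl
  · exact ⟨γ, HasRank.succ σ γ k hβ⟩
  · exact ⟨_, HasRank.limit σ β k hlim hβ⟩

/-- `τ` is a child of `σ` in the tree. -/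
def Child (τ σ : c.tree) : Prop := ∃ k : ℕ, τ.1 = σ.1 ++ [k]

theorem child_wellFounded : WellFounded c.Child := by
  refine Subrelation.wf (r := InvImage (· < ·) (fun σ : c.tree => Classical.choose σ.2)) ?_
    (InvImage.wf _ wellFounded_lt)
  rintro ⟨τ, hτ⟩ ⟨σ, hσ⟩ ⟨k, hk⟩
  simp only at hk
  subst hk
  exact (Classical.choose_spec hσ).child_lt (Classical.choose_spec hτ)

/-- The root `⟨⟩` of the tree. -/
def root : c.tree := ⟨[], α, HasRank.root⟩

/-- The child `σ⌢k` of a node which is not a leaf. -/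
def child (σ : c.tree) (hl : σ.1 ∉ c.leaves) (k : ℕ) : c.tree :=
  ⟨σ.1 ++ [k], c.child_mem_tree σ.2 hl k⟩

open Classical in
/-- The filter labelling `F^x` of the tree (with `true` for `1`): it agrees with `x` on the leaves,
and `F^x(σ) = 1` iff `{k | F^x(σ⌢k) = 1}` is cofinite when `σ` is not a leaf. -/
noncomputable def filterLabel (x : c.Space) : c.tree → Bool :=
  c.child_wellFounded.fix fun σ label =>
    if hl : σ.1 ∈ c.leaves then x ⟨σ.1, hl⟩
    else decide ({k : ℕ | label (c.child σ hl k) ⟨k, rfl⟩ = true}ᶜ.Finite)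

open Classical in
/-- The ideal labelling `I^x` of the tree (with `false` for `0`): it agrees with `x` on the leaves,
and `I^x(σ) = 0` iff `{k | I^x(σ⌢k) = 0}` is cofinite when `σ` is not a leaf. -/
noncomputable def idealLabel (x : c.Space) : c.tree → Bool :=
  c.child_wellFounded.fix fun σ label =>
    if hl : σ.1 ∈ c.leaves then x ⟨σ.1, hl⟩
    else !decide ({k : ℕ | label (c.child σ hl k) ⟨k, rfl⟩ = false}ᶜ.Finite)

theorem filterLabel_leaf (x : c.Space) (σ : c.tree) (hl : σ.1 ∈ c.leaves) :
    c.filterLabel x σ = x ⟨σ.1, hl⟩ := by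
  rw [filterLabel, WellFounded.fix_eq, dif_pos hl]

theorem filterLabel_node (x : c.Space) (σ : c.tree) (hl : σ.1 ∉ c.leaves) :
    c.filterLabel x σ = true ↔ {k : ℕ | c.filterLabel x (c.child σ hl k) = true}ᶜ.Finite := by
  classical
  conv_lhs => rw [filterLabel, WellFounded.fix_eq, dif_neg hl]
  exact decide_eq_true_iff

theorem idealLabel_leaf (x : c.Space) (σ : c.tree) (hl : σ.1 ∈ c.leaves) :
    c.idealLabel x σ = x ⟨σ.1, hl⟩ := by
  rw [idealLabel, WellFounded.fix_eq, dif_pos hl]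

theorem idealLabel_node (x : c.Space) (σ : c.tree) (hl : σ.1 ∉ c.leaves) :
    c.idealLabel x σ = false ↔ {k : ℕ | c.idealLabel x (c.child σ hl k) = false}ᶜ.Finite := by
  classical
  conv_lhs => rw [idealLabel, WellFounded.fix_eq, dif_neg hl, Bool.not_eq_false']
  exact decide_eq_true_iff

/-- The `α`-th iterate of the Fréchet filter, a subset of `2^{𝓛_α}`. -/
def frechetFilter : Set c.Space := {x | c.filterLabel x c.root = true}

/-- The `α`-th iterate of the Fréchet ideal, a subset of `2^{𝓛_α}`. -/
def frechetIdeal : Set c.Space := {x | c.idealLabel x c.root = false}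

end CofinalSequences

/-- The boldface Borel classes `Σ⁰_β` for `β ≥ 1`: `Σ⁰_1` consists of the open sets, and for
`β > 1` a set is `Σ⁰_β` iff it is a union of countably many sets whose complements are `Σ⁰_γ`
for some (varying) `1 ≤ γ < β`. -/
inductive BoldSigma {X : Type*} [TopologicalSpace X] : Ordinal.{0} → Set X → Prop
  | of_isOpen (U : Set X) : IsOpen U → BoldSigma 1 U
  | iUnion (β : Ordinal.{0}) (A : ℕ → Set X) (γ : ℕ → Ordinal.{0}) :
      (∀ n, 1 ≤ γ n ∧ γ n < β) → (∀ n, BoldSigma (γ n) (A n)ᶜ) → BoldSigma β (⋃ n, A n)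

/-- The boldface class `Δ⁰_β`: both the set and its complement are `Σ⁰_β`. -/
def BoldDelta {X : Type*} [TopologicalSpace X] (β : Ordinal.{0}) (A : Set X) : Prop :=
  BoldSigma β A ∧ BoldSigma β Aᶜ

/-- `Z` separates `A` from `B`. -/
def Separates {X : Type*} (Z A B : Set X) : Prop := A ⊆ Z ∧ B ⊆ Zᶜ

end IteratedFrechet

/-!
For `β ≥ 1`, a `Δ⁰_{β+1}` set is a pointwise limit of sets `B_k`, where `B_k` is `Δ⁰_{ρ_k+1}` and
the ordinals `ρ_k` are prescribed in advance, provided that every `γ < β` is eventually at most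
`ρ_k`. Descending along `T_α` in this way turns a `Δ⁰_{α+1}` set `A` into a map `f` that sends `A`
into `𝓕_α` and the complement of `A` into `𝓘_α`. The sets at the leaves are clopen, and postponing
them in the sequences `B_k` makes each coordinate of `f x` depend only on the coordinates of `x`
with a smaller number; such a map of `2^{𝓛_α}` to itself has a fixed point. If `Z` were a separating
`Δ⁰_{α+1}` set, then a fixed point `x` of the map for `A = Zᶜ` would satisfy `x ∈ Z` if and only if
`x ∉ Z`.
-/

open Filter

namespace IteratedFrechet

section BoldSigma

variable {X : Type*} [TopologicalSpace X] {A B : Set X} {β γ : Ordinal.{0}}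

theorem BoldSigma.one_le (hA : BoldSigma β A) : 1 ≤ β := by
  cases hA with
  | of_isOpen => exact le_rfl
  | iUnion _ _ γ hγ => exact (hγ 0).1.trans (hγ 0).2.le

theorem BoldSigma.iUnion_of_compl {κ : Type*} [Countable κ] [Nonempty κ] {A : κ → Set X}
    (hA : ∀ i, ∃ γ < β, BoldSigma γ (A i)ᶜ) : BoldSigma β (⋃ i, A i) := by
  obtain ⟨g, hg⟩ := exists_surjective_nat κ
  choose γ hγ hA using hA
  rw [← hg.iUnion_comp]
  exact .iUnion β _ (γ ∘ g) (fun n => ⟨(hA (g n)).one_le, hγ (g n)⟩) fun n => hA (g n)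

theorem BoldSigma.compl_of_lt (hA : BoldSigma γ A) (hγ : γ < β) : BoldSigma β Aᶜ := by
  rw [← Set.iUnion_const (ι := Unit) Aᶜ]
  exact .iUnion_of_compl fun _ => ⟨γ, hγ, by rwa [compl_compl]⟩

theorem boldSigma_one_iff : BoldSigma 1 A ↔ IsOpen A := by
  refine ⟨fun hA => ?_, .of_isOpen A⟩
  cases hA with
  | of_isOpen _ hA => exact hA
  | iUnion _ _ γ hγ => exact absurd (hγ 0).2 (hγ 0).1.not_gt

theorem boldSigma_iff_exists_iUnion (hβ : 1 < β) :
    BoldSigma β A ↔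
      ∃ B : ℕ → Set X, A = ⋃ n, B n ∧ ∀ n, ∃ γ < β, BoldSigma γ (B n)ᶜ := by
  constructor
  · intro hA
    cases hA with
    | of_isOpen => exact absurd hβ (lt_irrefl 1)
    | iUnion _ B γ hγ hB => exact ⟨B, rfl, fun n => ⟨γ n, (hγ n).2, hB n⟩⟩
  · rintro ⟨B, rfl, hB⟩
    exact .iUnion_of_compl hB

theorem BoldSigma.union (hA : BoldSigma β A) (hB : BoldSigma β B) : BoldSigma β (A ∪ B) := by
  rcases hA.one_le.eq_or_lt with rfl | hβ
  · exact boldSigma_one_iff.2 ((boldSigma_one_iff.1 hA).union (boldSigma_one_iff.1 hB))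
  obtain ⟨P, rfl, hP⟩ := (boldSigma_iff_exists_iUnion hβ).1 hA
  obtain ⟨Q, rfl, hQ⟩ := (boldSigma_iff_exists_iUnion hβ).1 hB
  rw [← Set.iUnion_sumElim]
  exact .iUnion_of_compl (Sum.rec hP hQ)

theorem BoldDelta.compl (hA : BoldDelta β A) : BoldDelta β Aᶜ :=
  ⟨hA.2, by rw [compl_compl]; exact hA.1⟩

variable [PerfectlyNormalSpace X]

theorem BoldSigma.mono (hA : BoldSigma γ A) (hγ : γ ≤ β) : BoldSigma β A := by
  rcases hγ.eq_or_lt with rfl | hγβ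
  · exact hA
  cases hA with
  | of_isOpen _ hA =>
    obtain ⟨U, hU, hAU⟩ := isGδ_iff_eq_iInter_nat.1 (isClosed_compl_iff.2 hA).isGδ
    rw [← compl_compl A, hAU, Set.compl_iInter]
    exact .iUnion_of_compl fun n => ⟨1, hγβ, by rw [compl_compl]; exact .of_isOpen _ (hU n)⟩
  | iUnion _ B δ hδ hB => exact .iUnion_of_compl fun n => ⟨δ n, (hδ n).2.trans hγβ, hB n⟩

theorem BoldSigma.inter (hA : BoldSigma β A) (hB : BoldSigma β B) : BoldSigma β (A ∩ B) := by
  rcases hA.one_le.eq_or_lt with rfl | hβ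
  · exact boldSigma_one_iff.2 ((boldSigma_one_iff.1 hA).inter (boldSigma_one_iff.1 hB))
  obtain ⟨P, rfl, hP⟩ := (boldSigma_iff_exists_iUnion hβ).1 hA
  obtain ⟨Q, rfl, hQ⟩ := (boldSigma_iff_exists_iUnion hβ).1 hB
  rw [Set.iUnion_inter_iUnion, ← Set.iUnion_prod' fun p : ℕ × ℕ => P p.1 ∩ Q p.2]
  refine .iUnion_of_compl fun ⟨m, n⟩ => ?_
  obtain ⟨γ, hγ, hPγ⟩ := hP m
  obtain ⟨δ, hδ, hQδ⟩ := hQ n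
  refine ⟨max γ δ, max_lt hγ hδ, ?_⟩
  rw [Set.compl_inter]
  exact (hPγ.mono (le_max_left γ δ)).union (hQδ.mono (le_max_right γ δ))

theorem BoldSigma.boldDelta (hA : BoldSigma γ A) (hγ : γ < β) : BoldDelta β A :=
  ⟨hA.mono hγ.le, hA.compl_of_lt hγ⟩

theorem boldDelta_of_isClopen (hβ : 1 ≤ β) (hA : IsClopen A) : BoldDelta β A :=
  ⟨(BoldSigma.of_isOpen A hA.isOpen).mono hβ,
    (BoldSigma.of_isOpen Aᶜ hA.isClosed.isOpen_compl).mono hβ⟩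

theorem BoldSigma.exists_iUnion_of_add_one (hβ : 1 ≤ β) (hA : BoldSigma (β + 1) A) :
    ∃ P : ℕ → Set X, A = ⋃ n, P n ∧ ∀ n, BoldSigma β (P n)ᶜ := by
  obtain ⟨P, rfl, hP⟩ := (boldSigma_iff_exists_iUnion (Order.lt_add_one_iff.2 hβ)).1 hA
  refine ⟨P, rfl, fun n => ?_⟩
  obtain ⟨γ, hγ, hPγ⟩ := hP n
  exact hPγ.mono (Order.lt_add_one_iff.1 hγ)

variable (X) in
/-- The Boolean algebra of the `Δ⁰_β` subsets of `X`, for `β ≥ 1`. -/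
def boldDeltaAlgebra (β : Ordinal.{0}) (hβ : 1 ≤ β) : BooleanSubalgebra (Set X) where
  carrier := {A | BoldDelta β A}
  supClosed' A hA B hB := by
    refine ⟨hA.1.union hB.1, ?_⟩
    rw [compl_sup]
    exact hA.2.inter hB.2
  infClosed' A hA B hB := by
    refine ⟨hA.1.inter hB.1, ?_⟩
    rw [compl_inf]
    exact hA.2.union hB.2
  compl_mem' hA := hA.compl
  bot_mem' := boldDelta_of_isClopen hβ isClopen_empty

end BoldSigma

section Approximation

variable {X : Type*} {𝒜 : ℕ → BooleanSubalgebra (Set X)}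

/-- `W` is the pointwise limit of supersets `R k ∈ 𝒜 k`. The `R k` need not be decreasing, since
the algebras `𝒜 k` are not assumed to be nested. -/
def ApproxFromAbove (𝒜 : ℕ → BooleanSubalgebra (Set X)) (W : Set X) : Prop :=
  ∃ R : ℕ → Set X, (∀ k, R k ∈ 𝒜 k) ∧ (∀ k, W ⊆ R k) ∧ ∀ x ∉ W, ∀ᶠ k in atTop, x ∉ R k

theorem approxFromAbove_iInter {T : ℕ → Set X} (hT : ∀ n, ∀ᶠ k in atTop, T n ∈ 𝒜 k) :
    ApproxFromAbove 𝒜 (⋂ n, T n) := by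
  refine ⟨fun k => ⋂ n ∈ {n | n ≤ k ∧ T n ∈ 𝒜 k}, T n, fun k => ?_, fun k => ?_, fun x hx => ?_⟩
  · exact BooleanSubalgebra.biInf_mem ((Set.finite_Iic k).subset fun _ hn => hn.1)
      fun _ hn => hn.2
  · exact Set.subset_iInter₂ fun n _ => Set.iInter_subset T n
  · obtain ⟨n, hn⟩ : ∃ n, x ∉ T n := by simpa only [Set.mem_iInter, not_forall] using hx
    filter_upwards [hT n, eventually_ge_atTop n] with k hk hnk hxk
    exact hn (Set.mem_iInter₂.1 hxk n ⟨hnk, hk⟩)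

theorem exists_eventually_mem_iff_of_approxFromAbove {P Q : ℕ → Set X}
    (hPQ : (⋃ n, P n)ᶜ = ⋃ n, Q n)
    (hP : ∀ n, ApproxFromAbove 𝒜 (P n)) (hQ : ∀ n, ApproxFromAbove 𝒜 (Q n)) :
    ∃ B : ℕ → Set X, (∀ k, B k ∈ 𝒜 k) ∧ ∀ x, ∀ᶠ k in atTop, x ∈ B k ↔ x ∈ ⋃ n, P n := by
  choose R hR hPR hRP using hP
  choose S hS hQS hSQ using hQ
  -- A race: the least `i` with `x ∈ R i k` against the least `j` with `x ∈ S j k`.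
  refine ⟨fun k => ⋃ i ∈ Set.Iic k, R i k ∩ ⋂ j ∈ Set.Iio i, (S j k)ᶜ, fun k => ?_, fun x => ?_⟩
  · refine BooleanSubalgebra.biSup_mem (Set.finite_Iic k) fun i _ => ?_
    exact BooleanSubalgebra.inf_mem (hR i k) (BooleanSubalgebra.biInf_mem (Set.finite_Iio i)
      fun j _ => BooleanSubalgebra.compl_mem (hS j k))
  by_cases hx : x ∈ ⋃ n, P n
  · obtain ⟨i, hi⟩ := Set.mem_iUnion.1 hx
    have hxQ (j : ℕ) : x ∉ Q j := fun hj => (hPQ ▸ Set.mem_iUnion_of_mem j hj) hx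
    filter_upwards [eventually_ge_atTop i,
      (Set.finite_Iio i).eventually_all.2 fun j _ => hSQ j x (hxQ j)] with k hik hxS
    exact iff_of_true (Set.mem_biUnion hik ⟨hPR i k hi, Set.mem_iInter₂.2 hxS⟩) hx
  · obtain ⟨j, hj⟩ := Set.mem_iUnion.1 (hPQ ▸ hx : x ∈ ⋃ n, Q n)
    have hxP (i : ℕ) : x ∉ P i := fun hi => hx (Set.mem_iUnion_of_mem i hi)
    filter_upwards [(Set.finite_Iic j).eventually_all.2 fun i _ => hRP i x (hxP i)] with k hxR
    refine iff_of_false (fun hxB => ?_) hx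
    obtain ⟨i, -, hxRi, hxSi⟩ := Set.mem_iUnion₂.1 hxB
    rcases le_or_gt i j with hij | hji
    · exact hxR i hij hxRi
    · exact Set.mem_iInter₂.1 hxSi j hji (hQS j k hj)

end Approximation

theorem exists_isFixedPt_of_dependsOn {ι : Type*} {π : ι → Type*} [∀ i, Nonempty (π i)]
    {r : ι → ι → Prop} (hr : WellFounded r) {f : (∀ i, π i) → ∀ i, π i}
    (hf : ∀ i, DependsOn (fun x => f x i) {j | r j i}) : ∃ x, Function.IsFixedPt f x := by
  classical
  let x : ∀ i, π i := hr.fix fun i ih =>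
    f (fun j => if hj : r j i then ih j hj else Classical.arbitrary (π j)) i
  refine ⟨x, funext fun i => ?_⟩
  have hxi : x i = f (fun j => if r j i then x j else Classical.arbitrary (π j)) i := hr.fix_eq _ i
  rw [hxi]
  exact hf i fun j hj => (if_pos hj).symm

section Cylinders

variable {ι : Type*} [Encodable ι] {π : ι → Type*}

variable (π) in
/-- The Boolean algebra of the sets that depend only on the coordinates with number below `n`. -/
def cylinderAlgebra (n : ℕ) : BooleanSubalgebra (Set (∀ i, π i)) where
  carrier := {A | DependsOn (· ∈ A) {i | Encodable.encode i < n}}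
  supClosed' _ hA _ hB _ _ h := congrArg₂ Or (hA h) (hB h)
  infClosed' _ hA _ hB _ _ h := congrArg₂ And (hA h) (hB h)
  compl_mem' hA _ _ h := congrArg Not (hA h)
  bot_mem' _ _ _ := rfl

theorem cylinderAlgebra_mono : Monotone (cylinderAlgebra π) :=
  fun _ _ hmn _ hA => hA.mono fun _ hi => lt_of_lt_of_le hi hmn

variable [∀ i, TopologicalSpace (π i)]

theorem exists_iInter_cylinder_of_isClosed {W : Set (∀ i, π i)} (hW : IsClosed W) :
    ∃ T : ℕ → Set (∀ i, π i), (∀ n, T n ∈ cylinderAlgebra π n) ∧ ⋂ n, T n = W := by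
  refine ⟨fun n => {x | ∃ y ∈ W, ∀ i, Encodable.encode i < n → x i = y i}, fun n x y hxy => ?_,
    Set.Subset.antisymm (fun x hx => ?_) (Set.subset_iInter fun n x hx => ⟨x, hx, fun _ _ => rfl⟩)⟩
  · refine propext (exists_congr fun z => and_congr_right fun _ => forall₂_congr fun i hi => ?_)
    rw [hxy i hi]
  · by_contra hxW
    obtain ⟨s, U, hU, hsU⟩ := isOpen_pi_iff.1 hW.isOpen_compl x hxW
    obtain ⟨y, hy, hxy⟩ := Set.mem_iInter.1 hx (s.sup Encodable.encode + 1)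
    refine hsU (fun i hi => ?_) hy
    rw [← hxy i (Nat.lt_succ_of_le (Finset.le_sup hi))]
    exact (hU i hi).2

variable [∀ i, DiscreteTopology (π i)]

theorem isOpen_of_mem_cylinderAlgebra {n : ℕ} {A : Set (∀ i, π i)}
    (hA : A ∈ cylinderAlgebra π n) : IsOpen A := by
  refine isOpen_iff_mem_nhds.2 fun x hx => ?_
  have hfin : {i : ι | Encodable.encode i < n}.Finite :=
    (Set.finite_Iio n).preimage Encodable.encode_injective.injOn
  filter_upwards [set_pi_mem_nhds hfin fun i _ => (isOpen_discrete {x i}).mem_nhds rfl] with y hy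
  exact (hA hy).mpr hx

theorem isClopen_of_mem_cylinderAlgebra {n : ℕ} {A : Set (∀ i, π i)}
    (hA : A ∈ cylinderAlgebra π n) : IsClopen A :=
  ⟨isOpen_compl_iff.1 (isOpen_of_mem_cylinderAlgebra (BooleanSubalgebra.compl_mem hA)),
    isOpen_of_mem_cylinderAlgebra hA⟩

variable (π) in
/-- The sets allowed at a node of rank `ρ` with number `n`: the `Δ⁰_{ρ+1}` sets, which for `ρ = 0`
are moreover required to depend only on the coordinates with number below `n`. -/
def levelAlgebra (ρ : Ordinal.{0}) (n : ℕ) : BooleanSubalgebra (Set (∀ i, π i)) :=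
  boldDeltaAlgebra (∀ i, π i) (ρ + 1) le_add_self ⊓ ⨅ _ : ρ = 0, cylinderAlgebra π n

variable {β ρ : Ordinal.{0}} {A : Set (∀ i, π i)}

theorem mem_levelAlgebra {n : ℕ} :
    A ∈ levelAlgebra π ρ n ↔ BoldDelta (ρ + 1) A ∧ (ρ = 0 → A ∈ cylinderAlgebra π n) := by
  rw [levelAlgebra, BooleanSubalgebra.mem_inf, BooleanSubalgebra.mem_iInf]
  rfl

theorem levelAlgebra_mono : Monotone (levelAlgebra π ρ) :=
  fun _ _ hmn => inf_le_inf_left _ (iInf_mono fun _ => cylinderAlgebra_mono hmn)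

theorem cylinderAlgebra_le_levelAlgebra (n : ℕ) : cylinderAlgebra π n ≤ levelAlgebra π ρ n :=
  fun _ hA => mem_levelAlgebra.2
    ⟨boldDelta_of_isClopen le_add_self (isClopen_of_mem_cylinderAlgebra hA), fun _ => hA⟩

theorem BoldSigma.mem_levelAlgebra {γ : Ordinal.{0}} (hA : BoldSigma γ A) (hγ : γ ≤ ρ) (n : ℕ) :
    A ∈ levelAlgebra π ρ n :=
  IteratedFrechet.mem_levelAlgebra.2 ⟨hA.boldDelta (Order.lt_add_one_iff.2 hγ),
    fun hρ => absurd hρ (zero_lt_one.trans_le (hA.one_le.trans hγ)).ne'⟩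

theorem approxFromAbove_of_boldSigma_compl {ρ : ℕ → Ordinal.{0}}
    (hρ : ∀ γ < β, ∀ᶠ k in atTop, γ ≤ ρ k) (hA : BoldSigma β Aᶜ) :
    ApproxFromAbove (fun k => levelAlgebra π (ρ k) k) A := by
  rcases hA.one_le.eq_or_lt with rfl | hβ
  · obtain ⟨T, hT, rfl⟩ :=
      exists_iInter_cylinder_of_isClosed (isOpen_compl_iff.1 (boldSigma_one_iff.1 hA))
    refine approxFromAbove_iInter fun n => ?_
    filter_upwards [eventually_ge_atTop n] with k hnk
    exact cylinderAlgebra_le_levelAlgebra k (cylinderAlgebra_mono hnk (hT n))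
  · obtain ⟨B, hAB, hB⟩ := (boldSigma_iff_exists_iUnion hβ).1 hA
    rw [← compl_compl A, hAB, Set.compl_iUnion]
    refine approxFromAbove_iInter fun n => ?_
    obtain ⟨γ, hγ, hBγ⟩ := hB n
    filter_upwards [hρ γ hγ] with k hk
    exact hBγ.mem_levelAlgebra hk k

theorem BoldDelta.exists_eventually_mem_iff (hβ : 1 ≤ β) {ρ : ℕ → Ordinal.{0}}
    (hρ : ∀ γ < β, ∀ᶠ k in atTop, γ ≤ ρ k) (hA : BoldDelta (β + 1) A) :
    ∃ B : ℕ → Set (∀ i, π i), (∀ k, B k ∈ levelAlgebra π (ρ k) k) ∧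
      ∀ x, ∀ᶠ k in atTop, x ∈ B k ↔ x ∈ A := by
  obtain ⟨P, rfl, hP⟩ := hA.1.exists_iUnion_of_add_one hβ
  obtain ⟨Q, hPQ, hQ⟩ := hA.2.exists_iUnion_of_add_one hβ
  exact exists_eventually_mem_iff_of_approxFromAbove hPQ
    (fun n => approxFromAbove_of_boldSigma_compl hρ (hP n))
    fun n => approxFromAbove_of_boldSigma_compl hρ (hQ n)

end Cylinders

theorem encode_le_encode_of_mem {α : Type*} [Encodable α] {a : α} :
    ∀ {σ : List α}, a ∈ σ → Encodable.encode a ≤ Encodable.encode σ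
  | b :: σ, h => by
    rw [Encodable.encode_list_cons]
    rcases List.mem_cons.1 h with rfl | h
    · exact (Nat.left_le_pair _ _).trans (Nat.le_succ _)
    · exact ((encode_le_encode_of_mem h).trans (Nat.right_le_pair _ _)).trans (Nat.le_succ _)

namespace CofinalSequences

variable {α : Ordinal.{0}} {c : CofinalSequences α} {σ : c.tree} {x y : c.Space}

noncomputable instance : Encodable c.leaves :=
  Encodable.ofInj Subtype.val Subtype.val_injective

theorem HasRank.exists_childRank {σ : List ℕ} {β : Ordinal.{0}} (hσ : c.HasRank σ β)
    (hβ : β ≠ 0) :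
    ∃ ρ : ℕ → Ordinal.{0}, (∀ k, c.HasRank (σ ++ [k]) (ρ k)) ∧
      ∀ γ < β, ∀ᶠ k in atTop, γ ≤ ρ k := by
  rcases Ordinal.zero_or_succ_or_isSuccLimit β with rfl | ⟨δ, rfl⟩ | hlim
  · exact absurd rfl hβ
  · exact ⟨fun _ => δ, fun k => .succ σ δ k hσ,
      fun γ hγ => Eventually.of_forall fun _ => Order.lt_succ_iff.1 hγ⟩
  · refine ⟨c.seq β, fun k => .limit σ β k hlim hσ, fun γ hγ => ?_⟩
    obtain ⟨n, hn⟩ := c.cofinal β hσ.le hlim γ hγ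
    filter_upwards [eventually_ge_atTop n] with k hk
    exact hn.trans ((c.strictMono β hσ.le hlim).monotone hk)

theorem filterLabel_eq_true_iff_eventually (hl : σ.1 ∉ c.leaves) :
    c.filterLabel x σ = true ↔ ∀ᶠ k in atTop, c.filterLabel x (c.child σ hl k) = true := by
  rw [c.filterLabel_node x σ hl, ← Nat.cofinite_eq_atTop]
  rfl

theorem idealLabel_eq_false_iff_eventually (hl : σ.1 ∉ c.leaves) :
    c.idealLabel x σ = false ↔ ∀ᶠ k in atTop, c.idealLabel x (c.child σ hl k) = false := by
  rw [c.idealLabel_node x σ hl, ← Nat.cofinite_eq_atTop]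
  rfl

variable (σ) in
theorem dependsOn_filterLabel : DependsOn (c.filterLabel · σ) {l : c.leaves | σ.1 <+: l.1} := by
  induction σ using c.child_wellFounded.induction with
  | _ σ ih =>
    intro x y hxy
    by_cases hl : σ.1 ∈ c.leaves
    · simp only [filterLabel_leaf _ _ _ hl]
      exact hxy ⟨σ.1, hl⟩ List.prefix_rfl
    · have hchild (k : ℕ) := ih (c.child σ hl k) ⟨k, rfl⟩
        fun l hkl => hxy l ((List.prefix_append σ.1 [k]).trans hkl)
      refine Bool.eq_iff_iff.2 ?_
      simp only [filterLabel_eq_true_iff_eventually hl, hchild]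

variable (σ) in
theorem dependsOn_idealLabel : DependsOn (c.idealLabel · σ) {l : c.leaves | σ.1 <+: l.1} := by
  induction σ using c.child_wellFounded.induction with
  | _ σ ih =>
    intro x y hxy
    by_cases hl : σ.1 ∈ c.leaves
    · simp only [idealLabel_leaf _ _ _ hl]
      exact hxy ⟨σ.1, hl⟩ List.prefix_rfl
    · have hchild (k : ℕ) := ih (c.child σ hl k) ⟨k, rfl⟩
        fun l hkl => hxy l ((List.prefix_append σ.1 [k]).trans hkl)
      refine Bool.not_inj (Bool.eq_iff_iff.2 ?_)
      simp only [Bool.not_eq_true', idealLabel_eq_false_iff_eventually hl, hchild]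

section Reduction

variable {ι : Type*} [Encodable ι] {π : ι → Type*} {A : Set (∀ i, π i)}

/-- `f` reduces membership in `A` to the labels of the node `σ`, each coordinate of `f x` being
determined by the coordinates of `x` with a smaller number. -/
structure Reduces (σ : c.tree) (A : Set (∀ i, π i)) (f : (∀ i, π i) → c.Space) : Prop where
  dependsOn (l : c.leaves) :
    DependsOn (fun x => f x l) {i | Encodable.encode i < Encodable.encode l}
  filterLabel_eq_true {x : ∀ i, π i} : x ∈ A → c.filterLabel (f x) σ = true
  idealLabel_eq_false {x : ∀ i, π i} : x ∉ A → c.idealLabel (f x) σ = false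

theorem exists_reduces_of_leaf (hl : σ.1 ∈ c.leaves)
    (hA : A ∈ cylinderAlgebra π (Encodable.encode σ.1)) : ∃ f, Reduces σ A f := by
  classical
  refine ⟨fun x l => decide (l = ⟨σ.1, hl⟩ ∧ x ∈ A), fun l x y hxy => ?_,
    fun hx => ?_, fun hx => ?_⟩
  · by_cases hlσ : l = ⟨σ.1, hl⟩
    · subst hlσ
      have hmem : (x ∈ A) = (y ∈ A) := hA hxy
      simp only [hmem]
    · simp only [hlσ, false_and]
  · simp only [filterLabel_leaf _ _ _ hl, hx, and_self, decide_true]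
  · simp only [idealLabel_leaf _ _ _ hl, hx, and_false, decide_false]

theorem Reduces.glue (hl : σ.1 ∉ c.leaves) {B : ℕ → Set (∀ i, π i)}
    (hBA : ∀ x, ∀ᶠ k in atTop, x ∈ B k ↔ x ∈ A) {g : ℕ → (∀ i, π i) → c.Space}
    (hg : ∀ k, Reduces (c.child σ hl k) (B k) (g k)) :
    Reduces σ A fun x l => g (l.1.getD σ.1.length 0) x l := by
  have hglue (x : ∀ i, π i) (k : ℕ) (l : c.leaves) (hkl : σ.1 ++ [k] <+: l.1) :
      g (l.1.getD σ.1.length 0) x l = g k x l := by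
    obtain ⟨τ, hτ⟩ := hkl
    simp [← hτ]
  refine ⟨fun l => (hg _).dependsOn l, fun {x} hx => ?_, fun {x} hx => ?_⟩
  · rw [filterLabel_eq_true_iff_eventually hl]
    filter_upwards [hBA x] with k hk
    exact (dependsOn_filterLabel _ (hglue x k)).trans ((hg k).filterLabel_eq_true (hk.2 hx))
  · rw [idealLabel_eq_false_iff_eventually hl]
    filter_upwards [hBA x] with k hk
    exact (dependsOn_idealLabel _ (hglue x k)).trans ((hg k).idealLabel_eq_false (mt hk.1 hx))

theorem exists_reduces [∀ i, TopologicalSpace (π i)] [∀ i, DiscreteTopology (π i)]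
    {β : Ordinal.{0}} (hσ : c.HasRank σ.1 β)
    (hA : A ∈ levelAlgebra π β (Encodable.encode σ.1)) : ∃ f, Reduces σ A f := by
  induction σ using c.child_wellFounded.induction generalizing β A with
  | _ σ ih =>
    rw [mem_levelAlgebra] at hA
    by_cases hl : σ.1 ∈ c.leaves
    · exact exists_reduces_of_leaf hl (hA.2 (hσ.unique hl))
    have hβ : β ≠ 0 := by rintro rfl; exact hl hσ
    obtain ⟨ρ, hρ, hρβ⟩ := hσ.exists_childRank hβ
    obtain ⟨B, hB, hBA⟩ := hA.1.exists_eventually_mem_iff (Order.one_le_iff_ne_zero.2 hβ) hρβ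
    have hle (k : ℕ) : k ≤ Encodable.encode (σ.1 ++ [k]) :=
      (Encodable.encode_nat k).symm.trans_le (encode_le_encode_of_mem List.mem_concat_self)
    choose g hg using fun k =>
      ih (c.child σ hl k) ⟨k, rfl⟩ (hρ k) (levelAlgebra_mono (hle k) (hB k))
    exact ⟨_, Reduces.glue hl hBA hg⟩

variable (c) in
theorem exists_reduces_root [∀ i, TopologicalSpace (π i)] [∀ i, DiscreteTopology (π i)]
    (hα : 1 ≤ α) (hA : BoldDelta (α + 1) A) : ∃ f, Reduces c.root A f :=
  exists_reduces .root <| mem_levelAlgebra.2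
    ⟨hA, fun hα₀ => absurd hα₀ (Order.one_le_iff_ne_zero.1 hα)⟩

end Reduction

end CofinalSequences

end IteratedFrechet

theorem mainTheorem8 (α : Ordinal.{0}) (hα : 1 ≤ α) (hα' : α < ω₁)
    (c : IteratedFrechet.CofinalSequences α) :
    ¬ ∃ Z : Set c.Space, IteratedFrechet.BoldDelta (α + 1) Z ∧
      IteratedFrechet.Separates Z c.frechetFilter c.frechetIdeal := by
  rintro ⟨Z, hZ, hFZ, hIZ⟩
  obtain ⟨f, hf⟩ := c.exists_reduces_root hα hZ.compl
  obtain ⟨x, hx⟩ := IteratedFrechet.exists_isFixedPt_of_dependsOn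
    (InvImage.wf Encodable.encode wellFounded_lt) hf.dependsOn
  have hF : x ∉ Z → x ∈ c.frechetFilter := fun hxZ => hx ▸ hf.filterLabel_eq_true hxZ
  have hI : x ∈ Z → x ∈ c.frechetIdeal := fun hxZ => hx ▸ hf.idealLabel_eq_false (not_not_intro hxZ)
  by_cases hxZ : x ∈ Z
  · exact hIZ (hI hxZ) hxZ
  · exact hxZ (hFZ (hF hxZ))
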